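/- **Theorem 1.4.** For $\lambda>0$ let $\Phi_\lambda(x)=\max(-\lambda,\min(x,\lambda))$, $x\in\mathbf R$, be the clipping operator, and for integers $1\le s\le n$ let $T_s=\{u\in\mathbf R^n:\|u\|_2\le 1,\ u \text{ has at most } s \text{ non-zero coordinates}\}$. Let $\mathcal V$ be a class of random vectors in Euclidean spaces $\mathbf R^n$ (the dimension $n$ may vary within the class) such that (i) for every $\varepsilon>0$ there is $\delta>0$ such that, for all $n$ and all $X\in\mathcal V$ with values in $\mathbf R^n$, $\ \sup_{v\in S^{n-1}}\mathbb P(|\langle X,v\rangle|\le\delta)\le\varepsilon$; (ii) for every $\delta>0$ there is $\tilde\varepsilon>0$ such that, for all $n$ and all $X\in\mathcal V$ with values in $\mathbf R^n$, $\ \inf_{u\in S^{n-1}}\mathbb P(|\langle X,u\rangle|\le\delta)\ge\tilde\varepsilon$. Then for every $\lambda>0$ there are $C(\lambda),c(\lambda)>0$ (depending only on $\lambda$ and $\mathcal V$) such that the following holds for all integers $1\le s\le n$, every $X\in\mathcal V$ with values in $\mathbf R^n$, and every $m\ge C(\lambda)\, s\,\log\left(\frac{en}{s}\right)$: if $X_1,\dots,X_m$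 are i.i.d. copies of $X$, then with probability at least $1-e^{-c(\lambda)m}$ one has, simultaneously for all $u,v\in T_s$, $$\frac1m\sum_{i=1}^m\left|\Phi_\lambda(\langle X_i,u\rangle)-\Phi_\lambda(\langle X_i,v\rangle)\right|^2\ \ge\ c(\lambda)\,\|u-v\|_2^2 .$$ -/

import Mathlib

open MeasureTheory ProbabilityTheory

universe u v

/-- A random vector in `ℝⁿ` (with the Euclidean norm), on a probability space of its own. -/
structure RandomVector (n : ℕ) : Type (u + 1) where
  /-- the sample space -/
  Ω : Type u
  /-- its events -/
  [mΩ : MeasurableSpace Ω]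
  /-- its probability -/
  P : Measure Ω
  [isProb : IsProbabilityMeasure P]
  /-- the vector itself -/
  X : Ω → EuclideanSpace ℝ (Fin n)
  measurable_X : Measurable X

attribute [instance] RandomVector.mΩ RandomVector.isProb

/-- The clipping operator `Φ_λ(x) = -λ ∨ x ∧ λ` on scalars. -/
noncomputable def clip (lam x : ℝ) : ℝ := max (-lam) (min x lam)

/-- `T_s`: the `s`-sparse vectors in the closed Euclidean unit ball of `ℝⁿ`. -/
def sparseBall (n s : ℕ) : Set (EuclideanSpace ℝ (Fin n)) :=
  {u | ‖u‖ ≤ 1 ∧ {i | u i ≠ 0}.ncard ≤ s}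

/-- The small-ball condition for a class `𝒱` of random vectors in Euclidean spaces (of possibly
different dimensions): for all `ε > 0` there is `δ > 0`, the same for the whole class, with
`sup_{v ∈ S^{n-1}} ℙ(|⟨X, v⟩| ≤ δ) ≤ ε`. The supremum is taken in `[0, ∞]`. -/
def SmallBall (𝒱 : (n : ℕ) → Set (RandomVector.{u} n)) : Prop :=
  ∀ ε : ℝ, 0 < ε → ∃ δ : ℝ, 0 < δ ∧ ∀ (n : ℕ), ∀ X ∈ 𝒱 n,
    (⨆ v ∈ Metric.sphere (0 : EuclideanSpace ℝ (Fin n)) 1,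
      X.P {ω | |inner ℝ (X.X ω) v| ≤ δ}) ≤ ENNReal.ofReal ε

/-- The reverse small-ball condition for a class `𝒱`: for all `δ > 0` there is `ε > 0`, the same
for the whole class, with `inf_{u ∈ S^{n-1}} ℙ(|⟨X, u⟩| ≤ δ) ≥ ε`. The infimum is taken in
`[0, ∞]`. -/
def ReverseSmallBall (𝒱 : (n : ℕ) → Set (RandomVector.{u} n)) : Prop :=
  ∀ δ : ℝ, 0 < δ → ∃ ε : ℝ, 0 < ε ∧ ∀ (n : ℕ), ∀ X ∈ 𝒱 n,
    ENNReal.ofReal ε ≤ ⨅ u ∈ Metric.sphere (0 : EuclideanSpace ℝ (Fin n)) 1,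
      X.P {ω | |inner ℝ (X.X ω) u| ≤ δ}

/-!
Fix `u, v` in `sparseBall n s` and put `w = (u - v) / ‖u - v‖`. If `|⟪x, u⟫| ≤ lam / 2` and
`|⟪x, w⟫| > b / 2`, then `⟪x, u⟫` is at distance at least `lam / 2` from the clipping levels, so
the clipped values of `⟪x, u⟫` and `⟪x, v⟫` differ by at least `min (b / 2 * ‖u - v‖) (lam / 2)`,
which is at least a constant times `‖u - v‖`. No joint information on `⟪x, u⟫` and `⟪x, v⟫` is
needed: by the reverse small-ball condition the first constraint has probability at least some `ε`,
and by the small-ball condition `b` can be taken so small that the second fails with probability at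
most `ε / 2`. Hence each pair `(u, w)` is good with probability at least `p = ε / 2`
(`le_measureReal_inter`), and it remains to see that, with high probability, all pairs are good for
a proportion `p / 32` of the sample points simultaneously (`le_mean_sq_clip_sub`).

As `X` may have arbitrarily heavy tails, approximation of `u` and `w` by a fixed finite net is of no
use, and the uniformity comes from Vapnik–Chervonenkis theory. For a fixed support `J` of size at
most `2 * s`, half-spaces in `ℝ^J` have VC dimension at most `2 * s + 1` by Radon's theorem, so the
Sauer–Shelah lemma bounds the number of traces of the good sets on `2 * m` points by
`exp (8 * x * m) / x ^ (4 * s + 2)` for every `x ∈ (0, 1]` (`ncard_slab_traces_le`). Symmetrization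
with an independent second sample and random swaps (`measure_pi_exists_card_lt_le`) turns this into
a probability bound with the factor `exp (-p * m / 32)`. The number of supports is at most
`exp (2 * s * log (e * n / s))`, and for `x` a small multiple of `p` and
`m ≥ C * s * log (e * n / s)` the exponential factor wins (`failure_bound_le`).
-/

/-! ### Counting the traces of half-spaces -/

/-- Half-spaces in a real vector space of dimension `d` have Vapnik–Chervonenkis dimension at most
`d + 1`: by Radon's theorem, `d + 2` points split into two parts whose convex hulls meet, and no
half-space contains the first part and misses the second. -/
theorem vcDim_le_finrank_add_one {ι V : Type*} [DecidableEq ι] [AddCommGroup V] [Module ℝ V]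
    [FiniteDimensional ℝ V] (𝒜 : Finset (Finset ι)) (y : ι → V) (t : ℝ)
    (h𝒜 : ∀ A ∈ 𝒜, ∃ l : Module.Dual ℝ V, ∀ i, i ∈ A ↔ t < l (y i)) :
    𝒜.vcDim ≤ Module.finrank ℝ V + 1 := by
  classical
  refine Finset.sup_le fun s hs => ?_
  rw [Finset.mem_shatterer] at hs
  by_contra! hcard
  have hdep : ¬ AffineIndependent ℝ (fun i : s => y i) := by
    intro h
    have h1 := h.card_le_finrank_succ
    have h2 := Submodule.finrank_le (vectorSpan ℝ (Set.range fun i : s => y i))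
    rw [Fintype.card_coe] at h1
    omega
  obtain ⟨I, c, hcI, hcI'⟩ := Convex.radon_partition hdep
  obtain ⟨A, hA, hsA⟩ := hs (t := (Finset.univ.filter fun i : s => i ∈ I).map
    (Function.Embedding.subtype _)) (by
      intro i hi
      obtain ⟨j, -, rfl⟩ := Finset.mem_map.1 hi
      exact j.2)
  obtain ⟨l, hl⟩ := h𝒜 A hA
  have hmem : ∀ i : s, (i : ι) ∈ A ↔ i ∈ I := by
    intro i
    have h1 : (i : ι) ∈ s ∩ A ↔ (i : ι) ∈ A := by simp
    rw [← h1, hsA]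
    simp
  have h1 : c ∈ l ⁻¹' Set.Ioi t := by
    refine convexHull_min ?_ ((convex_Ioi t).linear_preimage l) hcI
    rintro _ ⟨i, hi, rfl⟩
    exact (hl i).1 ((hmem i).2 hi)
  have h2 : c ∈ l ⁻¹' Set.Iic t := by
    refine convexHull_min ?_ ((convex_Iic t).linear_preimage l) hcI'
    rintro _ ⟨i, hi, rfl⟩
    exact not_lt.1 fun h => hi ((hmem i).1 ((hl i).2 h))
  exact not_lt.2 (show l c ≤ t from h2) h1

/-- Chernoff-type bound on a partial sum of binomial coefficients. -/
theorem sum_choose_le_exp_div_pow (N d : ℕ) {x : ℝ} (hx : 0 < x) (hx1 : x ≤ 1) :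
    ∑ k ∈ Finset.Iic d, (N.choose k : ℝ) ≤ Real.exp (x * N) / x ^ d := by
  rw [le_div_iff₀ (pow_pos hx d), Finset.sum_mul]
  calc ∑ k ∈ Finset.Iic d, (N.choose k : ℝ) * x ^ d
      ≤ ∑ k ∈ Finset.Iic d, (N.choose k : ℝ) * x ^ k := by
        refine Finset.sum_le_sum fun k hk => ?_
        exact mul_le_mul_of_nonneg_left
          (pow_le_pow_of_le_one hx.le hx1 (Finset.mem_Iic.1 hk)) (Nat.cast_nonneg _)
    _ ≤ ∑ k ∈ Finset.range (max N d + 1), (N.choose k : ℝ) * x ^ k := by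
        refine Finset.sum_le_sum_of_subset_of_nonneg ?_ fun _ _ _ => by positivity
        intro k hk
        rw [Finset.mem_Iic] at hk
        rw [Finset.mem_range]
        omega
    _ = ∑ k ∈ Finset.range (N + 1), (N.choose k : ℝ) * x ^ k := by
        symm
        refine Finset.sum_subset ?_ fun k _ hk => ?_
        · intro k hk
          rw [Finset.mem_range] at hk ⊢
          omega
        · rw [Finset.mem_range, not_lt] at hk
          rw [Nat.choose_eq_zero_of_lt (by omega)]
          simp
    _ = (x + 1) ^ N := by
        rw [add_pow]
        exact Finset.sum_congr rfl fun k _ => by simp [mul_comm]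
    _ ≤ Real.exp x ^ N := pow_le_pow_left₀ (by positivity) (Real.add_one_le_exp x) N
    _ = Real.exp (x * N) := by rw [← Real.exp_nat_mul, mul_comm]

open Classical in
/-- The Sauer–Shelah bound for the traces of half-spaces on a finite family of points; the
parameter `x` is free. -/
theorem ncard_halfspace_traces_le {ι V K : Type*} [Fintype ι] [AddCommGroup V] [Module ℝ V]
    [FiniteDimensional ℝ V] (y : ι → V) (l : K → Module.Dual ℝ V) (t : ℝ) {x : ℝ} (hx : 0 < x)
    (hx1 : x ≤ 1) :
    ((Set.range fun k => Finset.univ.filter fun i => t < l k (y i)).ncard : ℝ) ≤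
      Real.exp (x * Fintype.card ι) / x ^ (Module.finrank ℝ V + 1) := by
  set R := Set.range fun k => Finset.univ.filter fun i => t < l k (y i)
  have hR : R.Finite := Set.toFinite R
  have hvc : hR.toFinset.vcDim ≤ Module.finrank ℝ V + 1 := by
    refine vcDim_le_finrank_add_one _ y t fun A hA => ?_
    obtain ⟨k, rfl⟩ := hR.mem_toFinset.1 hA
    exact ⟨l k, fun i => by simp⟩
  have hcard : hR.toFinset.card ≤
      ∑ k ∈ Finset.Iic (Module.finrank ℝ V + 1), (Fintype.card ι).choose k :=
    (Finset.card_le_card_shatterer _).trans (Finset.card_shatterer_le_sum_vcDim.trans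
      (Finset.sum_le_sum_of_subset (Finset.Iic_subset_Iic.2 hvc)))
  rw [Set.ncard_eq_toFinset_card R hR]
  refine le_trans ?_ (sum_choose_le_exp_div_pow (Fintype.card ι) _ hx hx1)
  exact_mod_cast hcard

open Classical in
/-- Traces of the sets `{|l₁| ≤ a, b < |l₂|}`. On the points `±y i` such a trace is read off
from the traces of the two half-spaces `{a < l₁}` and `{b < l₂}`. -/
theorem ncard_slab_traces_le {ι V K : Type*} [Fintype ι] [AddCommGroup V] [Module ℝ V]
    [FiniteDimensional ℝ V] (y : ι → V) (l₁ l₂ : K → Module.Dual ℝ V) (a b : ℝ) {x : ℝ}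
    (hx : 0 < x) (hx1 : x ≤ 1) :
    ((Set.range fun k => Finset.univ.filter fun i =>
        |l₁ k (y i)| ≤ a ∧ b < |l₂ k (y i)|).ncard : ℝ) ≤
      (Real.exp (x * (2 * Fintype.card ι)) / x ^ (Module.finrank ℝ V + 1)) ^ 2 := by
  let z : ι × Bool → V := fun j => if j.2 then y j.1 else -y j.1
  let R₁ := Set.range fun k => Finset.univ.filter fun j => a < l₁ k (z j)
  let R₂ := Set.range fun k => Finset.univ.filter fun j => b < l₂ k (z j)
  let F : Finset (ι × Bool) × Finset (ι × Bool) → Finset ι := fun T => Finset.univ.filter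
    fun i => ((i, true) ∉ T.1 ∧ (i, false) ∉ T.1) ∧ ((i, true) ∈ T.2 ∨ (i, false) ∈ T.2)
  have hsub : (Set.range fun k => Finset.univ.filter fun i =>
      |l₁ k (y i)| ≤ a ∧ b < |l₂ k (y i)|) ⊆ F '' (R₁ ×ˢ R₂) := by
    rintro _ ⟨k, rfl⟩
    refine ⟨(Finset.univ.filter fun j => a < l₁ k (z j),
        Finset.univ.filter fun j => b < l₂ k (z j)),
      ⟨⟨k, rfl⟩, ⟨k, rfl⟩⟩, ?_⟩
    ext i
    simp only [F, z, Finset.mem_filter, Finset.mem_univ, true_and, if_true, Bool.false_eq_true,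
      if_false, map_neg, not_lt, abs_le', lt_abs]
  have hle : (Set.range fun k => Finset.univ.filter fun i =>
      |l₁ k (y i)| ≤ a ∧ b < |l₂ k (y i)|).ncard ≤ R₁.ncard * R₂.ncard := by
    refine (Set.ncard_le_ncard hsub (Set.toFinite _)).trans
      ((Set.ncard_image_le (Set.toFinite _)).trans_eq Set.ncard_prod)
  have hN : ((Fintype.card (ι × Bool) : ℕ) : ℝ) = 2 * Fintype.card ι := by
    rw [Fintype.card_prod, Fintype.card_bool]
    push_cast
    ring
  have h₁ := ncard_halfspace_traces_le z l₁ a hx hx1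
  have h₂ := ncard_halfspace_traces_le z l₂ b hx hx1
  rw [hN] at h₁ h₂
  calc _ ≤ ((R₁.ncard * R₂.ncard : ℕ) : ℝ) := by exact_mod_cast hle
    _ ≤ _ := by
      rw [Nat.cast_mul, sq]
      exact mul_le_mul h₁ h₂ (Nat.cast_nonneg _) (by positivity)

/-! ### Symmetrization -/

theorem exp_neg_one_le_half : Real.exp (-1) ≤ 1 / 2 := by
  rw [Real.exp_neg, one_div]
  exact inv_anti₀ (by norm_num) (by linarith [Real.add_one_le_exp (1 : ℝ)])

theorem exp_neg_card_filter {ι : Type*} [Fintype ι] (q : ι → Prop) [DecidablePred q] :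
    Real.exp (-((Finset.univ.filter q).card : ℝ)) = ∏ i, if q i then Real.exp (-1) else 1 := by
  rw [← Finset.prod_filter, Finset.prod_const, ← Real.exp_nat_mul]
  ring_nf

open Classical in
/-- Chernoff bound for the lower tail of the number of sample points in a set. -/
theorem measure_pi_card_lt_le {E ι : Type*} [MeasurableSpace E] [Fintype ι] (μ : Measure E)
    [IsProbabilityMeasure μ] {G : Set E} (hG : MeasurableSet G) {p : ℝ} (hpG : p ≤ μ.real G) :
    (Measure.pi fun _ : ι => μ).real
      {x | ((Finset.univ.filter fun i => x i ∈ G).card : ℝ) < p * Fintype.card ι / 4} ≤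
      Real.exp (-(p * Fintype.card ι / 4)) := by
  set M : ℝ := (Fintype.card ι : ℝ) with hM
  let f : E → ℝ := fun e => if e ∈ G then Real.exp (-1) else 1
  have hf : f = fun e => 1 - (1 - Real.exp (-1)) * G.indicator 1 e := by
    funext e
    by_cases he : e ∈ G <;> simp [f, he]
  have hfi : Integrable f μ := by
    rw [hf]
    exact (integrable_const _).sub
      (((integrable_indicator_iff hG).2 (integrable_const _).integrableOn).const_mul _)
  have hf0 : ∀ e, 0 ≤ f e := fun e => by
    by_cases he : e ∈ G <;> simp [f, he, Real.exp_nonneg]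
  have hint : ∫ e, f e ∂μ ≤ Real.exp (-(p / 2)) := by
    have h1 : ∫ e, f e ∂μ = 1 - (1 - Real.exp (-1)) * μ.real G := by
      rw [hf, integral_sub (integrable_const _)
        (((integrable_indicator_iff hG).2 (integrable_const _).integrableOn).const_mul _),
        integral_const_mul, integral_indicator_one hG]
      simp
    rw [h1]
    have h2 := Real.add_one_le_exp (-(p / 2))
    have h3 : (1 / 2) * μ.real G ≤ (1 - Real.exp (-1)) * μ.real G :=
      mul_le_mul_of_nonneg_right (by linarith [exp_neg_one_le_half]) measureReal_nonneg
    linarith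
  have hmarkov := mul_meas_ge_le_integral_of_nonneg (μ := Measure.pi fun _ : ι => μ)
    (f := fun x => ∏ i, f (x i)) (ae_of_all _ fun x => Finset.prod_nonneg fun i _ => hf0 _)
    (Integrable.fintype_prod fun _ => hfi) (Real.exp (-(p * M / 4)))
  rw [integral_fintype_prod_eq_pow] at hmarkov
  have hpow : (∫ e, f e ∂μ) ^ Fintype.card ι ≤ Real.exp (-(p * M / 4)) * Real.exp (-(p * M / 4)) :=
    calc _ ≤ Real.exp (-(p / 2)) ^ Fintype.card ι :=
          pow_le_pow_left₀ (integral_nonneg hf0) hint _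
      _ = _ := by
          rw [← Real.exp_nat_mul, ← Real.exp_add]
          congr 1
          rw [hM]
          ring
  have hle := le_of_mul_le_mul_left (hmarkov.trans hpow) (Real.exp_pos _)
  refine le_trans (measureReal_mono fun x hx => ?_) hle
  simp only [Set.mem_ofPred_eq, f] at hx ⊢
  rw [← exp_neg_card_filter fun i => x i ∈ G, Real.exp_le_exp]
  linarith

/-- Exchanging the two coordinates of a pair when `b` is true. -/
def swapIf {E : Type*} (b : Bool) (e : E × E) : E × E := if b then e.swap else e

/-- Random swaps are unlikely to concentrate the `true` entries of an array in its second column.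
If `H` rows have a `true` entry, then `exp (-#)`, for the number `#` of `true` entries of the first
column, has mean at most `((1 + e⁻¹) / 2) ^ H ≤ e ^ (-H / 4)`. -/
theorem card_swaps_le {ι : Type*} [Fintype ι] [DecidableEq ι] (T : ι → Bool × Bool) (a : ℝ) :
    ((Finset.univ.filter fun σ : ι → Bool =>
        ((Finset.univ.filter fun i => (swapIf (σ i) (T i)).1 = true).card : ℝ) < a / 8 ∧
        a ≤ ((Finset.univ.filter fun i => (swapIf (σ i) (T i)).2 = true).card : ℝ)).card : ℝ) ≤
      2 ^ Fintype.card ι * Real.exp (-(a / 8)) := by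
  set S := Finset.univ.filter fun σ : ι → Bool =>
        ((Finset.univ.filter fun i => (swapIf (σ i) (T i)).1 = true).card : ℝ) < a / 8 ∧
        a ≤ ((Finset.univ.filter fun i => (swapIf (σ i) (T i)).2 = true).card : ℝ)
  rcases S.eq_empty_or_nonempty with h0 | ⟨σ₀, hσ₀⟩
  · rw [h0]
    simp only [Finset.card_empty, Nat.cast_zero]
    positivity
  let H := Finset.univ.filter fun i => (T i).1 = true ∨ (T i).2 = true
  have hH : a ≤ (H.card : ℝ) := by
    refine (Finset.mem_filter.1 hσ₀).2.2.trans ?_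
    refine Nat.cast_le.2 (Finset.card_le_card fun i hi => ?_)
    refine Finset.mem_filter.2 ⟨Finset.mem_univ i, ?_⟩
    replace hi := (Finset.mem_filter.1 hi).2
    unfold swapIf at hi
    split_ifs at hi
    · exact Or.inl hi
    · exact Or.inr hi
  have hexp : (3 / 4 : ℝ) ≤ Real.exp (-(1 / 4)) := by
    linarith [Real.add_one_le_exp (-(1 / 4) : ℝ)]
  have hfac : ∀ i, ∑ b : Bool, (if (swapIf b (T i)).1 = true then Real.exp (-1) else 1) ≤
      2 * if (T i).1 = true ∨ (T i).2 = true then Real.exp (-(1 / 4)) else 1 := by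
    intro i
    have h1 := exp_neg_one_le_half
    rcases T i with ⟨_ | _, _ | _⟩ <;> simp [swapIf] <;> norm_num at hexp <;> linarith
  have hsum : ∑ σ : ι → Bool,
      Real.exp (-((Finset.univ.filter fun i => (swapIf (σ i) (T i)).1 = true).card : ℝ)) ≤
      2 ^ Fintype.card ι * Real.exp (-(a / 4)) := by
    calc _ = ∏ i, ∑ b : Bool, (if (swapIf b (T i)).1 = true then Real.exp (-1) else 1) := by
          rw [Finset.prod_univ_sum, Fintype.piFinset_univ]
          exact Finset.sum_congr rfl fun σ _ => exp_neg_card_filter _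
      _ ≤ ∏ i, (2 * if (T i).1 = true ∨ (T i).2 = true then Real.exp (-(1 / 4)) else 1) :=
          Finset.prod_le_prod (fun i _ => Finset.sum_nonneg fun b _ => by
            split_ifs <;> positivity) fun i _ => hfac i
      _ = 2 ^ Fintype.card ι * Real.exp (-(H.card / 4)) := by
          rw [Finset.prod_mul_distrib, Finset.prod_const, Finset.card_univ, ← Finset.prod_filter,
            Finset.prod_const, ← Real.exp_nat_mul]
          congr 2
          ring
      _ ≤ _ := by
          gcongr
  have hlow : (S.card : ℝ) * Real.exp (-(a / 8)) ≤ ∑ σ : ι → Bool,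
      Real.exp (-((Finset.univ.filter fun i => (swapIf (σ i) (T i)).1 = true).card : ℝ)) := by
    rw [← nsmul_eq_mul]
    refine (Finset.card_nsmul_le_sum S _ _ fun σ hσ => ?_).trans
      (Finset.sum_le_sum_of_subset_of_nonneg (Finset.subset_univ S) fun _ _ _ => Real.exp_nonneg _)
    exact Real.exp_le_exp.2 (neg_le_neg (Finset.mem_filter.1 hσ).2.1.le)
  have hsplit : Real.exp (-(a / 4)) = Real.exp (-(a / 8)) * Real.exp (-(a / 8)) := by
    rw [← Real.exp_add]
    ring_nf
  refine le_of_mul_le_mul_right ?_ (Real.exp_pos (-(a / 8)))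
  calc _ ≤ _ := hlow.trans hsum
    _ = _ := by rw [hsplit]; ring

theorem measurePreserving_swapIf {E ι : Type*} [MeasurableSpace E] [Fintype ι] (μ : Measure E)
    [IsProbabilityMeasure μ] (σ : ι → Bool) :
    MeasurePreserving (fun (z : ι → E × E) i => swapIf (σ i) (z i))
      (Measure.pi fun _ => μ.prod μ) (Measure.pi fun _ => μ.prod μ) := by
  refine measurePreserving_pi (fun _ => μ.prod μ) (fun _ => μ.prod μ) fun i => ?_
  cases hσ : σ i
  · exact MeasurePreserving.id _
  · exact Measure.measurePreserving_swap

open Classical in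
theorem measurable_card_filter_mem {E ι Ω : Type*} [MeasurableSpace E] [Fintype ι]
    [MeasurableSpace Ω] {G : Set E} (hG : MeasurableSet G) {f : ι → Ω → E}
    (hf : ∀ i, Measurable (f i)) :
    Measurable fun x => ((Finset.univ.filter fun i => f i x ∈ G).card : ℝ) := by
  simp only [Finset.card_filter, Nat.cast_sum, Nat.cast_ite, Nat.cast_one, Nat.cast_zero]
  exact Finset.measurable_sum _ fun i _ =>
    Measurable.ite (hf i hG) measurable_const measurable_const

open Classical in
/-- For a fixed pair of samples, the union bound over the traces of the family on the `2 * card ι`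
sample points, with `card_swaps_le` for each trace. -/
theorem card_swaps_exists_le {E ι K : Type*} [Fintype ι] (G : K → Set E) {N : ℝ}
    (hN : ∀ z : ι × Bool → E,
      ((Set.range fun k => Finset.univ.filter fun j => z j ∈ G k).ncard : ℝ) ≤ N)
    (a : ℝ) (z : ι → E × E) :
    ((Finset.univ.filter fun σ : ι → Bool => ∃ k,
        ((Finset.univ.filter fun i => (swapIf (σ i) (z i)).1 ∈ G k).card : ℝ) < a / 8 ∧
        a ≤ ((Finset.univ.filter fun i => (swapIf (σ i) (z i)).2 ∈ G k).card : ℝ)).card : ℝ) ≤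
      N * (2 ^ Fintype.card ι * Real.exp (-(a / 8))) := by
  let zz : ι × Bool → E := fun j => if j.2 then (z j.1).2 else (z j.1).1
  set R := Set.range fun k => Finset.univ.filter fun j => zz j ∈ G k
  have hRf : R.Finite := Set.toFinite R
  let arr : Finset (ι × Bool) → ι → Bool × Bool := fun T i =>
    (decide ((i, false) ∈ T), decide ((i, true) ∈ T))
  let S : Finset (ι × Bool) → Finset (ι → Bool) := fun T =>
    Finset.univ.filter fun σ : ι → Bool =>
        ((Finset.univ.filter fun i => (swapIf (σ i) (arr T i)).1 = true).card : ℝ) < a / 8 ∧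
        a ≤ ((Finset.univ.filter fun i => (swapIf (σ i) (arr T i)).2 = true).card : ℝ)
  have hsub : (Finset.univ.filter fun σ : ι → Bool => ∃ k,
        ((Finset.univ.filter fun i => (swapIf (σ i) (z i)).1 ∈ G k).card : ℝ) < a / 8 ∧
        a ≤ ((Finset.univ.filter fun i => (swapIf (σ i) (z i)).2 ∈ G k).card : ℝ)) ⊆
      hRf.toFinset.biUnion S := by
    intro σ hσ
    obtain ⟨k, hk⟩ := (Finset.mem_filter.1 hσ).2
    refine Finset.mem_biUnion.2 ⟨Finset.univ.filter fun j => zz j ∈ G k,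
      hRf.mem_toFinset.2 ⟨k, rfl⟩, Finset.mem_filter.2 ⟨Finset.mem_univ σ, ?_⟩⟩
    have h1 : ∀ i, (swapIf (σ i) (arr (Finset.univ.filter fun j => zz j ∈ G k) i)).1 = true ↔
        (swapIf (σ i) (z i)).1 ∈ G k := by
      intro i
      cases hi : σ i <;> simp [swapIf, arr, zz]
    have h2 : ∀ i, (swapIf (σ i) (arr (Finset.univ.filter fun j => zz j ∈ G k) i)).2 = true ↔
        (swapIf (σ i) (z i)).2 ∈ G k := by
      intro i
      cases hi : σ i <;> simp [swapIf, arr, zz]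
    simpa only [h1, h2] using hk
  have hcard := (Finset.card_le_card hsub).trans Finset.card_biUnion_le
  calc _ ≤ ((∑ T ∈ hRf.toFinset, (S T).card : ℕ) : ℝ) := by exact_mod_cast hcard
    _ = ∑ T ∈ hRf.toFinset, ((S T).card : ℝ) := by push_cast; rfl
    _ ≤ ∑ T ∈ hRf.toFinset, 2 ^ Fintype.card ι * Real.exp (-(a / 8)) :=
        Finset.sum_le_sum fun T _ => card_swaps_le (arr T) a
    _ = (R.ncard : ℝ) * (2 ^ Fintype.card ι * Real.exp (-(a / 8))) := by
        rw [Finset.sum_const, nsmul_eq_mul, Set.ncard_eq_toFinset_card R hRf]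
    _ ≤ _ := mul_le_mul_of_nonneg_right (hN zz) (by positivity)

open Classical in
/-- Averaging over the `2 ^ card ι` coordinatewise swaps, each of which preserves the law of the
pair of samples. -/
theorem measure_pi_prod_exists_le {E ι K : Type*} [MeasurableSpace E] [Fintype ι] [Countable K]
    (μ : Measure E) [IsProbabilityMeasure μ] {G : K → Set E} (hG : ∀ k, MeasurableSet (G k))
    {N : ℝ} (hN : ∀ z : ι × Bool → E,
      ((Set.range fun k => Finset.univ.filter fun j => z j ∈ G k).ncard : ℝ) ≤ N) (a : ℝ) :
    (Measure.pi fun _ : ι => μ.prod μ) {z | ∃ k,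
        ((Finset.univ.filter fun i => (z i).1 ∈ G k).card : ℝ) < a / 8 ∧
        a ≤ ((Finset.univ.filter fun i => (z i).2 ∈ G k).card : ℝ)} ≤
      ENNReal.ofReal (N * Real.exp (-(a / 8))) := by
  set ρ := Measure.pi fun _ : ι => μ.prod μ
  set D : Set (ι → E × E) := {z | ∃ k,
        ((Finset.univ.filter fun i => (z i).1 ∈ G k).card : ℝ) < a / 8 ∧
        a ≤ ((Finset.univ.filter fun i => (z i).2 ∈ G k).card : ℝ)} with hD
  have hDm : MeasurableSet D := by
    rw [hD, Set.ofPred_exists]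
    refine MeasurableSet.iUnion fun k => MeasurableSet.inter ?_ ?_
    · exact measurableSet_lt (measurable_card_filter_mem (hG k)
        fun i => (measurable_pi_apply i).fst) measurable_const
    · exact measurableSet_le measurable_const (measurable_card_filter_mem (hG k)
        fun i => (measurable_pi_apply i).snd)
  let sw : (ι → Bool) → (ι → E × E) → ι → E × E := fun σ z i => swapIf (σ i) (z i)
  have hsw : ∀ σ, MeasurePreserving (sw σ) ρ ρ := measurePreserving_swapIf μ
  have hsum : (2 ^ Fintype.card ι : ENNReal) * ρ D =
      ∫⁻ z, ∑ σ : ι → Bool, (sw σ ⁻¹' D).indicator 1 z ∂ρ := by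
    rw [lintegral_finsetSum _ fun σ _ =>
      measurable_one.indicator ((hsw σ).measurable hDm)]
    simp only [fun σ => lintegral_indicator_one (μ := ρ) ((hsw σ).measurable hDm),
      fun σ => (hsw σ).measure_preimage hDm.nullMeasurableSet]
    simp
  have hpt : ∀ z, ∑ σ : ι → Bool, (sw σ ⁻¹' D).indicator (1 : (ι → E × E) → ENNReal) z ≤
      ENNReal.ofReal (2 ^ Fintype.card ι * (N * Real.exp (-(a / 8)))) := by
    intro z
    have h1 : ∑ σ : ι → Bool, (sw σ ⁻¹' D).indicator (1 : (ι → E × E) → ENNReal) z =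
        ((Finset.univ.filter fun σ => sw σ z ∈ D).card : ENNReal) := by
      simp only [Set.indicator_apply, Set.mem_preimage, Pi.one_apply]
      rw [Finset.sum_boole]
    rw [h1, ← ENNReal.ofReal_natCast]
    refine ENNReal.ofReal_le_ofReal (le_trans (card_swaps_exists_le G hN a z) (le_of_eq ?_))
    ring
  have hle : (2 ^ Fintype.card ι : ENNReal) * ρ D ≤
      2 ^ Fintype.card ι * ENNReal.ofReal (N * Real.exp (-(a / 8))) := by
    rw [hsum]
    refine (lintegral_mono hpt).trans (le_of_eq ?_)
    rw [lintegral_const, measure_univ, mul_one, ENNReal.ofReal_mul (by positivity),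
      ENNReal.ofReal_pow (by norm_num), ENNReal.ofReal_ofNat]
  exact (ENNReal.mul_le_mul_iff_right (by positivity) (by finiteness)).1 hle

open Classical in
/-- Uniform lower bound for empirical frequencies over a countable class of sets of measure at
least `p`, in terms of the number `N` of traces of the class on twice the sample size. A sample in
which some set of the class is rarely hit is followed, with probability at least one half, by an
independent second sample in which the same set is hit often. -/
theorem measure_pi_exists_card_lt_le {E ι K : Type*} [MeasurableSpace E] [Fintype ι] [Countable K]
    (μ : Measure E) [IsProbabilityMeasure μ] {G : K → Set E} (hG : ∀ k, MeasurableSet (G k))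
    {p : ℝ} (hpG : ∀ k, p ≤ μ.real (G k)) (hp : 4 ≤ p * Fintype.card ι)
    {N : ℝ} (hN : ∀ z : ι × Bool → E,
      ((Set.range fun k => Finset.univ.filter fun j => z j ∈ G k).ncard : ℝ) ≤ N) :
    (Measure.pi fun _ : ι => μ) {x | ∃ k,
        ((Finset.univ.filter fun i => x i ∈ G k).card : ℝ) < p * Fintype.card ι / 32} ≤
      ENNReal.ofReal (2 * N * Real.exp (-(p * Fintype.card ι / 32))) := by
  set a : ℝ := p * Fintype.card ι / 4 with ha
  have ha8 : p * Fintype.card ι / 32 = a / 8 := by rw [ha]; ring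
  rw [ha8]
  set ν := Measure.pi fun _ : ι => μ
  set B : Set (ι → E) := {x | ∃ k,
    ((Finset.univ.filter fun i => x i ∈ G k).card : ℝ) < a / 8} with hB
  have hBm : MeasurableSet B := by
    rw [hB, Set.ofPred_exists]
    exact MeasurableSet.iUnion fun k => measurableSet_lt
      (measurable_card_filter_mem (hG k) measurable_pi_apply) measurable_const
  let D : Set ((ι → E) × (ι → E)) := {z | ∃ k,
        ((Finset.univ.filter fun i => z.1 i ∈ G k).card : ℝ) < a / 8 ∧
        a ≤ ((Finset.univ.filter fun i => z.2 i ∈ G k).card : ℝ)}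
  have hDm : MeasurableSet D := by
    simp only [D]
    rw [Set.ofPred_exists]
    refine MeasurableSet.iUnion fun k => MeasurableSet.inter ?_ ?_
    · exact measurableSet_lt (measurable_card_filter_mem (hG k)
        fun i => (measurable_pi_apply i).comp measurable_fst) measurable_const
    · exact measurableSet_le measurable_const (measurable_card_filter_mem (hG k)
        fun i => (measurable_pi_apply i).comp measurable_snd)
  have hDle : (ν.prod ν) D ≤ ENNReal.ofReal (N * Real.exp (-(a / 8))) := by
    rw [← (measurePreserving_arrowProdEquivProdArrow E E ι (fun _ => μ)
      (fun _ => μ)).measure_preimage hDm.nullMeasurableSet]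
    exact measure_pi_prod_exists_le μ hG hN a
  have hsec : ∀ x ∈ B, (2 : ENNReal)⁻¹ ≤ ν (Prod.mk x ⁻¹' D) := by
    rintro x ⟨k, hk⟩
    set A : Set (ι → E) := {y | ((Finset.univ.filter fun i => y i ∈ G k).card : ℝ) < a}
    have hAm : MeasurableSet A := measurableSet_lt
      (measurable_card_filter_mem (hG k) measurable_pi_apply) measurable_const
    have hAle : ν.real A ≤ 1 / 2 := by
      refine (measure_pi_card_lt_le μ (hG k) (hpG k)).trans (le_trans ?_ exp_neg_one_le_half)
      exact Real.exp_le_exp.2 (by linarith)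
    have hAc : (2 : ENNReal)⁻¹ ≤ ν Aᶜ := by
      have h1 : (1 / 2 : ℝ) ≤ ν.real Aᶜ := by
        rw [probReal_compl_eq_one_sub hAm]
        linarith
      have h2 := ENNReal.ofReal_le_ofReal h1
      rw [ofReal_measureReal, one_div, ENNReal.ofReal_inv_of_pos (by norm_num),
        ENNReal.ofReal_ofNat] at h2
      exact h2
    refine hAc.trans (measure_mono fun y hy => ?_)
    exact ⟨k, hk, not_lt.1 hy⟩
  have hhalf : (2 : ENNReal)⁻¹ * ν B ≤ (ν.prod ν) D := by
    rw [Measure.prod_apply hDm, ← setLIntegral_const]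
    exact (setLIntegral_mono' hBm hsec).trans (setLIntegral_le_lintegral _ _)
  calc ν B = 2 * ((2 : ENNReal)⁻¹ * ν B) := by
        rw [← mul_assoc, ENNReal.mul_inv_cancel (by norm_num) (by norm_num), one_mul]
    _ ≤ 2 * ENNReal.ofReal (N * Real.exp (-(a / 8))) := by
        gcongr
        exact hhalf.trans hDle
    _ = _ := by
        rw [mul_assoc 2 N, ENNReal.ofReal_mul (p := 2) (by norm_num), ENNReal.ofReal_ofNat]

/-! ### Sparse vectors -/

/-- Pairs of vectors supported in `J`, the first in the unit ball and the second on the unit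
sphere. -/
def supportedPairs {n : ℕ} (J : Finset (Fin n)) :
    Set (EuclideanSpace ℝ (Fin n) × EuclideanSpace ℝ (Fin n)) :=
  {q | (∀ i ∉ J, q.1 i = 0) ∧ (∀ i ∉ J, q.2 i = 0) ∧ ‖q.1‖ ≤ 1 ∧ ‖q.2‖ = 1}

theorem inner_eq_sum_of_supported {n : ℕ} {J : Finset (Fin n)} {u : EuclideanSpace ℝ (Fin n)}
    (hu : ∀ i ∉ J, u i = 0) (x : EuclideanSpace ℝ (Fin n)) :
    (∑ i : J, u i • LinearMap.proj i : Module.Dual ℝ (J → ℝ)) (fun i => x i) = inner ℝ x u := by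
  rw [PiLp.inner_apply]
  simp only [LinearMap.sum_apply, LinearMap.smul_apply, LinearMap.proj_apply, smul_eq_mul,
    RCLike.inner_apply, conj_trivial]
  rw [Finset.sum_coe_sort J fun i => u i * x i]
  exact Finset.sum_subset (Finset.subset_univ J) fun i _ hi => by simp [hu i hi]

open Classical in
/-- The uniform lower bound for one support `J`. The uniform bound for countable classes is applied
to a countable dense subset of `supportedPairs J`; relaxing `a` to `2 * a` and `b` to `b / 2` passes
from this subset to all pairs. -/
theorem measure_pi_exists_supportedPairs_le {n : ℕ} {ι : Type*} [Fintype ι] (J : Finset (Fin n))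
    (μ : Measure (EuclideanSpace ℝ (Fin n))) [IsProbabilityMeasure μ] {a b p x : ℝ} (ha : 0 < a)
    (hb : 0 < b) (hx : 0 < x) (hx1 : x ≤ 1)
    (hμ : ∀ q ∈ supportedPairs J, p ≤ μ.real {e | |inner ℝ e q.1| ≤ a ∧ b < |inner ℝ e q.2|})
    (hp : 4 ≤ p * Fintype.card ι) :
    (Measure.pi fun _ : ι => μ) {e | ∃ q ∈ supportedPairs J,
        ((Finset.univ.filter fun i => |inner ℝ (e i) q.1| ≤ 2 * a ∧
          b / 2 < |inner ℝ (e i) q.2|).card : ℝ) < p * Fintype.card ι / 32} ≤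
      ENNReal.ofReal (2 * (Real.exp (4 * x * Fintype.card ι) / x ^ (J.card + 1)) ^ 2 *
        Real.exp (-(p * Fintype.card ι / 32))) := by
  obtain ⟨D, hDc, hDd⟩ := TopologicalSpace.exists_countable_dense (supportedPairs J)
  have : Countable D := hDc.to_subtype
  let G : D → Set (EuclideanSpace ℝ (Fin n)) := fun k =>
    {e | |inner ℝ e k.1.1.1| ≤ a ∧ b < |inner ℝ e k.1.1.2|}
  have hG : ∀ k, MeasurableSet (G k) := by
    intro k
    refine MeasurableSet.inter ?_ ?_
    · exact measurableSet_le (f := fun e => |inner ℝ e k.1.1.1|) (by fun_prop) measurable_const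
    · exact measurableSet_lt (g := fun e => |inner ℝ e k.1.1.2|) measurable_const (by fun_prop)
  have hGmem : ∀ k e, e ∈ G k ↔ |inner ℝ e k.1.1.1| ≤ a ∧ b < |inner ℝ e k.1.1.2| :=
    fun _ _ => Iff.rfl
  have hGp : ∀ k, p ≤ μ.real (G k) := fun k => hμ k.1.1 k.1.2
  clear_value G
  have hN : ∀ z : ι × Bool → EuclideanSpace ℝ (Fin n),
      ((Set.range fun k => Finset.univ.filter fun j => z j ∈ G k).ncard : ℝ) ≤
        (Real.exp (4 * x * Fintype.card ι) / x ^ (J.card + 1)) ^ 2 := by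
    intro z
    have h := ncard_slab_traces_le (K := D) (fun j (i : J) => z j i)
      (fun k => ∑ i : J, k.1.1.1 i • LinearMap.proj i)
      (fun k => ∑ i : J, k.1.1.2 i • LinearMap.proj i) a b hx hx1
    simp only [fun k : D => inner_eq_sum_of_supported k.1.2.1,
      fun k : D => inner_eq_sum_of_supported k.1.2.2.1] at h
    simp only [hGmem]
    refine h.trans (le_of_eq ?_)
    rw [Fintype.card_prod, Fintype.card_bool, Module.finrank_fintype_fun_eq_card, Fintype.card_coe]
    push_cast
    ring_nf
  refine le_trans (measure_mono ?_)
    (measure_pi_exists_card_lt_le μ hG hGp hp hN)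
  rintro e ⟨q, hq, hlt⟩
  -- `q'` is close enough to `q` to change every `⟪e i, q.1⟫` by less than `a` and every
  -- `⟪e i, q.2⟫` by less than `b / 2`.
  obtain ⟨q', hq'D, hq'⟩ := hDd.exists_mem_open
    (U := {q' : supportedPairs J | ∀ i, |inner ℝ (e i) (q'.1.1 - q.1)| < a ∧
      |inner ℝ (e i) (q'.1.2 - q.2)| < b / 2})
    (by
      simp only [Set.ofPred_forall]
      refine isOpen_iInter_of_finite fun i => IsOpen.inter ?_ ?_
      · exact isOpen_lt (f := fun q' : supportedPairs J => |inner ℝ (e i) (q'.1.1 - q.1)|)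
          (by fun_prop) continuous_const
      · exact isOpen_lt (f := fun q' : supportedPairs J => |inner ℝ (e i) (q'.1.2 - q.2)|)
          (by fun_prop) continuous_const)
    ⟨⟨q, hq⟩, fun i => by simp [ha, hb]⟩
  refine ⟨⟨q', hq'D⟩, lt_of_le_of_lt ?_ hlt⟩
  refine Nat.cast_le.2 (Finset.card_le_card fun i hi => ?_)
  refine Finset.mem_filter.2 ⟨Finset.mem_univ i, ?_⟩
  obtain ⟨h1, h2⟩ := (hGmem _ _).1 (Finset.mem_filter.1 hi).2
  obtain ⟨h3, h4⟩ := hq' i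
  simp only at h1 h2
  rw [inner_sub_right] at h3 h4
  have h5 := abs_sub_abs_le_abs_sub (inner ℝ (e i) q.1) (inner ℝ (e i) q'.1.1)
  have h6 := abs_sub_abs_le_abs_sub (inner ℝ (e i) q'.1.2) (inner ℝ (e i) q.2)
  rw [abs_sub_comm] at h5
  constructor <;> linarith

theorem one_le_log_exp_one_mul_div {n s : ℕ} (hs : 1 ≤ s) (hsn : s ≤ n) :
    1 ≤ Real.log (Real.exp 1 * n / s) := by
  have hs0 : (0 : ℝ) < s := by exact_mod_cast hs
  rw [Real.le_log_iff_exp_le (by have : (0 : ℝ) < n := hs0.trans_le (by exact_mod_cast hsn)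
                                 positivity), le_div_iff₀ hs0]
  exact mul_le_mul_of_nonneg_left (by exact_mod_cast hsn) (Real.exp_nonneg _)

theorem card_supports_le {n s : ℕ} (hs : 1 ≤ s) (hsn : s ≤ n) :
    ((Finset.univ.filter fun J : Finset (Fin n) => J.card ≤ 2 * s).card : ℝ) ≤
      Real.exp (2 * s * Real.log (Real.exp 1 * n / s)) := by
  have hs0 : (0 : ℝ) < s := by exact_mod_cast hs
  have hsn' : (s : ℝ) ≤ n := by exact_mod_cast hsn
  have hn0 : (0 : ℝ) < n := hs0.trans_le hsn'
  have hsub : (Finset.univ.filter fun J : Finset (Fin n) => J.card ≤ 2 * s) ⊆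
      (Finset.Iic (2 * s)).biUnion fun k => Finset.powersetCard k Finset.univ := by
    intro J hJ
    refine Finset.mem_biUnion.2 ⟨J.card, Finset.mem_Iic.2 (Finset.mem_filter.1 hJ).2, ?_⟩
    exact Finset.mem_powersetCard.2 ⟨Finset.subset_univ J, rfl⟩
  have hcard := (Finset.card_le_card hsub).trans Finset.card_biUnion_le
  simp only [Finset.card_powersetCard, Finset.card_univ, Fintype.card_fin] at hcard
  have hlog : Real.log (Real.exp 1 * n / s) = 1 + Real.log (n / s) := by
    rw [mul_div_assoc, Real.log_mul (Real.exp_pos 1).ne' (by positivity), Real.log_exp]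
  calc _ ≤ ∑ k ∈ Finset.Iic (2 * s), (n.choose k : ℝ) := by exact_mod_cast hcard
    _ ≤ Real.exp ((s / n : ℝ) * n) / (s / n : ℝ) ^ (2 * s) :=
        sum_choose_le_exp_div_pow n (2 * s) (by positivity) ((div_le_one hn0).2 hsn')
    _ = Real.exp s * (n / s : ℝ) ^ (2 * s) := by
        rw [div_mul_cancel₀ _ hn0.ne', div_eq_mul_inv, ← inv_pow, inv_div]
    _ = Real.exp (s + 2 * s * Real.log (n / s)) := by
        rw [Real.exp_add, ← Real.exp_log (show (0 : ℝ) < (n / s : ℝ) by positivity),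
          ← Real.exp_nat_mul, Real.exp_log (by positivity)]
        push_cast
        rfl
    _ ≤ _ := by
        rw [Real.exp_le_exp, hlog]
        linarith

open Classical in
/-- The union bound over the supports. -/
theorem measure_pi_exists_sparse_le {n s : ℕ} (hs : 1 ≤ s) (hsn : s ≤ n) {ι : Type*} [Fintype ι]
    (μ : Measure (EuclideanSpace ℝ (Fin n))) [IsProbabilityMeasure μ] {a b p x : ℝ} (ha : 0 < a)
    (hb : 0 < b) (hx : 0 < x) (hx1 : x ≤ 1)
    (hμ : ∀ u w : EuclideanSpace ℝ (Fin n), ‖u‖ ≤ 1 → ‖w‖ = 1 →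
      p ≤ μ.real {e | |inner ℝ e u| ≤ a ∧ b < |inner ℝ e w|})
    (hp : 4 ≤ p * Fintype.card ι) :
    (Measure.pi fun _ : ι => μ) {e | ∃ J : Finset (Fin n), J.card ≤ 2 * s ∧
        ∃ q ∈ supportedPairs J,
        ((Finset.univ.filter fun i => |inner ℝ (e i) q.1| ≤ 2 * a ∧
          b / 2 < |inner ℝ (e i) q.2|).card : ℝ) < p * Fintype.card ι / 32} ≤
      ENNReal.ofReal (Real.exp (2 * s * Real.log (Real.exp 1 * n / s)) *
        (2 * (Real.exp (4 * x * Fintype.card ι) / x ^ (2 * s + 1)) ^ 2 *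
        Real.exp (-(p * Fintype.card ι / 32)))) := by
  set F := Finset.univ.filter fun J : Finset (Fin n) => J.card ≤ 2 * s
  let B : Finset (Fin n) → Set (ι → EuclideanSpace ℝ (Fin n)) := fun J =>
    {e | ∃ q ∈ supportedPairs J,
        ((Finset.univ.filter fun i => |inner ℝ (e i) q.1| ≤ 2 * a ∧
          b / 2 < |inner ℝ (e i) q.2|).card : ℝ) < p * Fintype.card ι / 32}
  set r := 2 * (Real.exp (4 * x * Fintype.card ι) / x ^ (2 * s + 1)) ^ 2 *
        Real.exp (-(p * Fintype.card ι / 32)) with hr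
  have hB : ∀ J ∈ F, (Measure.pi fun _ : ι => μ) (B J) ≤ ENNReal.ofReal r := by
    intro J hJ
    have hJ' : J.card ≤ 2 * s := (Finset.mem_filter.1 hJ).2
    refine (measure_pi_exists_supportedPairs_le J μ ha hb hx hx1
      (fun q hq => hμ q.1 q.2 hq.2.2.1 hq.2.2.2) hp).trans (ENNReal.ofReal_le_ofReal ?_)
    have hpow : x ^ (2 * s + 1) ≤ x ^ (J.card + 1) :=
      pow_le_pow_of_le_one hx.le hx1 (by omega)
    rw [hr]
    gcongr
  calc _ ≤ (Measure.pi fun _ : ι => μ) (⋃ J ∈ F, B J) := by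
        refine measure_mono ?_
        rintro e ⟨J, hJ, he⟩
        exact Set.mem_biUnion (Finset.mem_filter.2 ⟨Finset.mem_univ J, hJ⟩ : J ∈ F) he
    _ ≤ ∑ J ∈ F, (Measure.pi fun _ : ι => μ) (B J) := measure_biUnion_finset_le _ _
    _ ≤ ∑ J ∈ F, ENNReal.ofReal r := Finset.sum_le_sum hB
    _ = ENNReal.ofReal (F.card * r) := by
        rw [Finset.sum_const, nsmul_eq_mul, ENNReal.ofReal_mul (Nat.cast_nonneg _),
          ENNReal.ofReal_natCast]
    _ ≤ _ := by
        refine ENNReal.ofReal_le_ofReal (mul_le_mul_of_nonneg_right (card_supports_le hs hsn) ?_)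
        rw [hr]
        positivity

/-- The probability bound of `measure_pi_exists_sparse_le` at `x = p / 1024`. This choice leaves a
linear term `p * m / 128` from the number of traces, a quarter of the gain `p * m / 32`; the lower
bound on `m` absorbs the terms proportional to `s * L`. -/
theorem failure_bound_le {s : ℕ} {p m L : ℝ} (hs : 1 ≤ s) (hp : 0 < p) (hp1 : p ≤ 1) (hL : 1 ≤ L)
    (hm : 128 * (3 + 6 * Real.log (1024 / p)) / p * s * L ≤ m) :
    Real.exp (2 * s * L) * (2 * (Real.exp (4 * (p / 1024) * m) / (p / 1024) ^ (2 * s + 1)) ^ 2 *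
      Real.exp (-(p * m / 32))) ≤ Real.exp (-(p * m / 64)) := by
  have hs' : (1 : ℝ) ≤ s := by exact_mod_cast hs
  set l := Real.log (1024 / p) with hl
  have hl0 : 0 ≤ l := Real.log_nonneg ((one_le_div hp).2 (by linarith))
  have hx : p / 1024 = Real.exp (-l) := by
    rw [hl, Real.exp_neg, Real.exp_log (by positivity), inv_div]
  have h2 : (2 : ℝ) ≤ Real.exp 1 := by linarith [Real.add_one_le_exp (1 : ℝ)]
  have hm' : 128 * (3 + 6 * l) * (s * L) ≤ p * m := by
    have h := mul_le_mul_of_nonneg_left hm hp.le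
    calc _ = p * (128 * (3 + 6 * l) / p * s * L) := by field_simp
      _ ≤ _ := h
  have hsL : (s : ℝ) ≤ s * L := le_mul_of_one_le_right (by positivity) hL
  have hls : l * s ≤ l * (s * L) := mul_le_mul_of_nonneg_left hsL hl0
  have hl1 : l ≤ l * s := le_mul_of_one_le_right hl0 hs'
  calc _ ≤ Real.exp (2 * s * L) * (Real.exp 1 * (Real.exp (p / 256 * m) /
        Real.exp (-l) ^ (2 * s + 1)) ^ 2 * Real.exp (-(p * m / 32))) := by
        rw [← hx, show 4 * (p / 1024) * m = p / 256 * m by ring]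
        gcongr
    _ = Real.exp (2 * s * L + (1 + 2 * (p / 256 * m - (2 * s + 1) * -l) + -(p * m / 32))) := by
        rw [← Real.exp_nat_mul, ← Real.exp_sub, ← Real.exp_nat_mul, ← Real.exp_add,
          ← Real.exp_add, ← Real.exp_add]
        push_cast
        ring_nf
    _ ≤ _ := by
        rw [Real.exp_le_exp]
        nlinarith

/-! ### Single pairs, clipping, and the final estimate -/

/-- The mass of `{|⟪e, u⟫| ≤ a, b < |⟪e, w⟫|}` under the two small-ball conditions. Scaling reduces
`‖u‖ ≤ 1` to `‖u‖ = 1`. -/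
theorem le_measureReal_inter {E : Type*} [NormedAddCommGroup E] [InnerProductSpace ℝ E]
    [MeasurableSpace E] [BorelSpace E] (μ : Measure E) [IsProbabilityMeasure μ] {a b ε : ℝ}
    (ha : 0 < a) (h1 : ∀ u : E, ‖u‖ = 1 → ε ≤ μ.real {e | |inner ℝ e u| ≤ a})
    (h2 : ∀ w : E, ‖w‖ = 1 → μ.real {e | |inner ℝ e w| ≤ b} ≤ ε / 2) (u w : E) (hu : ‖u‖ ≤ 1)
    (hw : ‖w‖ = 1) : ε / 2 ≤ μ.real {e | |inner ℝ e u| ≤ a ∧ b < |inner ℝ e w|} := by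
  have hu' : ε ≤ μ.real {e | |inner ℝ e u| ≤ a} := by
    rcases eq_or_ne u 0 with rfl | hu0
    · refine (h1 w hw).trans (measureReal_mono fun e _ => ?_)
      simp [ha.le]
    · have hn : 0 < ‖u‖ := norm_pos_iff.2 hu0
      refine (h1 (‖u‖⁻¹ • u) (norm_smul_inv_norm (𝕜 := ℝ) hu0)).trans
        (measureReal_mono fun e he => ?_)
      have he' : |inner ℝ e (‖u‖⁻¹ • u)| ≤ a := he
      rw [real_inner_smul_right, abs_mul, abs_of_pos (inv_pos.2 hn), inv_mul_le_iff₀ hn] at he'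
      exact he'.trans (mul_le_of_le_one_left ha.le hu)
  have hsub : {e : E | |inner ℝ e u| ≤ a} ⊆
      {e | |inner ℝ e u| ≤ a ∧ b < |inner ℝ e w|} ∪ {e | |inner ℝ e w| ≤ b} := by
    intro e he
    rcases lt_or_ge b |inner ℝ e w| with h | h
    · exact Or.inl ⟨he, h⟩
    · exact Or.inr h
  have h3 := (measureReal_mono (μ := μ) hsub).trans (measureReal_union_le _ _)
  linarith [h2 w hw]

theorem abs_clip_sub_clip_ge {lam a b : ℝ} (hlam : 0 < lam) (ha : |a| ≤ lam / 2) :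
    min |a - b| (lam / 2) ≤ |clip lam a - clip lam b| := by
  unfold clip
  grind

theorem exists_common_support {n s : ℕ} {u v : EuclideanSpace ℝ (Fin n)}
    (hu : u ∈ sparseBall n s) (hv : v ∈ sparseBall n s) :
    ∃ J : Finset (Fin n), J.card ≤ 2 * s ∧ ∀ i ∉ J, u i = 0 ∧ v i = 0 := by
  classical
  have hcard : ∀ z ∈ sparseBall n s, (Finset.univ.filter fun i => z i ≠ 0).card ≤ s := by
    intro z hz
    rw [← Set.ncard_coe_finset, Finset.coe_filter_univ]
    exact hz.2
  refine ⟨Finset.univ.filter (fun i => u i ≠ 0) ∪ Finset.univ.filter (fun i => v i ≠ 0),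
    (Finset.card_union_le _ _).trans ?_, fun i hi => ?_⟩
  · have h1 := hcard u hu
    have h2 := hcard v hv
    omega
  · simpa [not_or] using hi

open Classical in
/-- Deterministic part of the argument: if every pair supported on at most `2 * s` coordinates
meets the two constraints for a proportion `p / 32` of the points, then the clipped measurements
separate the points of `sparseBall n s`. -/
theorem le_mean_sq_clip_sub {n s : ℕ} {ι : Type*} [Fintype ι] [Nonempty ι] {lam b p c : ℝ}
    (hlam : 0 < lam) (hb : 0 < b) (hc : c ≤ p / 32 * min (b / 2) (lam / 4) ^ 2)
    (e : ι → EuclideanSpace ℝ (Fin n))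
    (he : ∀ J : Finset (Fin n), J.card ≤ 2 * s → ∀ q ∈ supportedPairs J,
      p * Fintype.card ι / 32 ≤ ((Finset.univ.filter fun i => |inner ℝ (e i) q.1| ≤ lam / 2 ∧
          b / 2 < |inner ℝ (e i) q.2|).card : ℝ))
    {u v : EuclideanSpace ℝ (Fin n)} (hu : u ∈ sparseBall n s) (hv : v ∈ sparseBall n s) :
    c * ‖u - v‖ ^ 2 ≤ (1 / (Fintype.card ι : ℝ)) * ∑ i,
      |clip lam (inner ℝ (e i) u) - clip lam (inner ℝ (e i) v)| ^ 2 := by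
  set κ := min (b / 2) (lam / 4)
  have hκ0 : 0 < κ := lt_min (by positivity) (by positivity)
  have hm : (0 : ℝ) < Fintype.card ι := Nat.cast_pos.2 Fintype.card_pos
  rcases eq_or_ne u v with rfl | huv
  · simp
  have hd : 0 < ‖u - v‖ := norm_pos_iff.2 (sub_ne_zero.2 huv)
  have hd2 : ‖u - v‖ ≤ 2 := (norm_sub_le u v).trans (by linarith [hu.1, hv.1])
  obtain ⟨J, hJ, hJ0⟩ := exists_common_support hu hv
  have hq : (u, ‖u - v‖⁻¹ • (u - v)) ∈ supportedPairs J := by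
    refine ⟨fun i hi => (hJ0 i hi).1, fun i hi => ?_, hu.1,
      norm_smul_inv_norm (𝕜 := ℝ) (sub_ne_zero.2 huv)⟩
    simp [(hJ0 i hi).1, (hJ0 i hi).2]
  set S := Finset.univ.filter fun i => |inner ℝ (e i) u| ≤ lam / 2 ∧
          b / 2 < |inner ℝ (e i) (‖u - v‖⁻¹ • (u - v))|
  have hScard : p * Fintype.card ι / 32 ≤ (S.card : ℝ) := he J hJ (u, ‖u - v‖⁻¹ • (u - v)) hq
  have hterm : ∀ i ∈ S, κ ^ 2 * ‖u - v‖ ^ 2 ≤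
      |clip lam (inner ℝ (e i) u) - clip lam (inner ℝ (e i) v)| ^ 2 := by
    intro i hi
    obtain ⟨h1, h2⟩ := (Finset.mem_filter.1 hi).2
    rw [real_inner_smul_right, abs_mul, abs_of_pos (inv_pos.2 hd), inner_sub_right,
      inv_mul_eq_div, lt_div_iff₀ hd] at h2
    rw [← mul_pow]
    refine pow_le_pow_left₀ (by positivity) (le_trans (le_min ?_ ?_)
      (abs_clip_sub_clip_ge hlam h1)) 2
    · exact (mul_le_mul_of_nonneg_right (min_le_left _ _) hd.le).trans h2.le
    · calc κ * ‖u - v‖ ≤ lam / 4 * 2 :=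
            mul_le_mul (min_le_right _ _) hd2 hd.le (by positivity)
        _ = lam / 2 := by ring
  have hsum : (S.card : ℝ) * (κ ^ 2 * ‖u - v‖ ^ 2) ≤ ∑ i,
      |clip lam (inner ℝ (e i) u) - clip lam (inner ℝ (e i) v)| ^ 2 := by
    rw [← nsmul_eq_mul]
    exact (Finset.card_nsmul_le_sum S _ _ hterm).trans
      (Finset.sum_le_sum_of_subset_of_nonneg (Finset.subset_univ S) fun _ _ _ => by positivity)
  rw [one_div, le_inv_mul_iff₀ hm]
  calc _ ≤ Fintype.card ι * (p / 32 * κ ^ 2 * ‖u - v‖ ^ 2) := by gcongr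
    _ = p * Fintype.card ι / 32 * (κ ^ 2 * ‖u - v‖ ^ 2) := by ring
    _ ≤ _ := (mul_le_mul_of_nonneg_right hScard (by positivity)).trans hsum

/-- Lower bound for the outer measure of the complement of a bad event. -/
theorem ofReal_one_sub_le_measure_of_compl_subset {α : Type*} [MeasurableSpace α] (ν : Measure α)
    [IsProbabilityMeasure ν] {B : Set α} {r : ℝ} (hr : 0 ≤ r) (hB : ν B ≤ ENNReal.ofReal r) :
    ENNReal.ofReal (1 - r) ≤ ν Bᶜ := by
  have h1 : (1 : ENNReal) ≤ ν B + ν Bᶜ := by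
    rw [← measure_univ (μ := ν), ← Set.union_compl_self B]
    exact measure_union_le _ _
  rw [ENNReal.ofReal_sub _ hr, ENNReal.ofReal_one, tsub_le_iff_left]
  exact h1.trans (by gcongr)

theorem theorem1p4 (𝒱 : (n : ℕ) → Set (RandomVector.{u} n))
    (hsb : SmallBall 𝒱) (hrsb : ReverseSmallBall 𝒱) (lam : ℝ) (hlam : 0 < lam) :
    ∃ C c : ℝ, 0 < C ∧ 0 < c ∧
      ∀ (n s m : ℕ), 1 ≤ s → s ≤ n →
        C * s * Real.log (Real.exp 1 * n / s) ≤ m →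
        ∀ X ∈ 𝒱 n,
        ∀ (Ω : Type v) [MeasurableSpace Ω] (P : Measure Ω) [IsProbabilityMeasure P]
          (Y : Fin m → Ω → EuclideanSpace ℝ (Fin n)),
          iIndepFun Y P →
          (∀ i, IdentDistrib (Y i) X.X P X.P) →
          ENNReal.ofReal (1 - Real.exp (-(c * m))) ≤
            P {ω | ∀ u ∈ sparseBall n s, ∀ v ∈ sparseBall n s,
              c * ‖u - v‖ ^ 2 ≤
                (1 / (m : ℝ)) * ∑ i : Fin m,
                  |clip lam (inner ℝ (Y i ω) u) - clip lam (inner ℝ (Y i ω) v)| ^ 2} := by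
  classical
  obtain ⟨ε₀, hε₀, h₁⟩ := hrsb (lam / 4) (by positivity)
  -- The cap at `1` makes the constants below meaningful for an empty class as well.
  set ε := min ε₀ 1 with hε
  have hεpos : 0 < ε := lt_min hε₀ one_pos
  obtain ⟨b, hb, h₂⟩ := hsb (ε / 2) (by positivity)
  set p := ε / 2 with hp
  have hp0 : 0 < p := by positivity
  have hp1 : p ≤ 1 := by linarith [min_le_right ε₀ 1]
  have hlog : 0 ≤ Real.log (1024 / p) := Real.log_nonneg ((one_le_div hp0).2 (by linarith))
  set c := min (p / 64) (p / 32 * min (b / 2) (lam / 4) ^ 2)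
  have hκ : 0 < min (b / 2) (lam / 4) := lt_min (by positivity) (by positivity)
  refine ⟨128 * (3 + 6 * Real.log (1024 / p)) / p, c, by positivity,
    lt_min (by positivity) (by positivity), ?_⟩
  intro n s m hs hsn hm X hX Ω _ P _ Y hind hid
  have hL := one_le_log_exp_one_mul_div hs hsn
  set L := Real.log (Real.exp 1 * n / s)
  have hs' : (1 : ℝ) ≤ s := by exact_mod_cast hs
  have hpm : 4 ≤ p * m := by
    have hsL : 1 ≤ s * L := one_le_mul_of_one_le_of_one_le hs' hL
    calc (4 : ℝ) ≤ 128 * (3 + 6 * Real.log (1024 / p)) * (s * L) := by nlinarith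
      _ = p * (128 * (3 + 6 * Real.log (1024 / p)) / p * s * L) := by field_simp
      _ ≤ _ := mul_le_mul_of_nonneg_left hm hp0.le
  have hm0 : 0 < m := by
    rcases Nat.eq_zero_or_pos m with h | h
    · rw [h] at hpm
      norm_num at hpm
    · exact h
  have : Nonempty (Fin m) := ⟨⟨0, hm0⟩⟩
  set μ : Measure (EuclideanSpace ℝ (Fin n)) := X.P.map X.X
  have : IsProbabilityMeasure μ := Measure.isProbabilityMeasure_map X.measurable_X.aemeasurable
  have hset : ∀ (t : ℝ) (w : EuclideanSpace ℝ (Fin n)),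
      μ {e | |inner ℝ e w| ≤ t} = X.P {ω | |inner ℝ (X.X ω) w| ≤ t} := fun t w =>
    Measure.map_apply X.measurable_X
      (measurableSet_le (f := fun e => |inner ℝ e w|) (by fun_prop) measurable_const)
  have hmass : ∀ u w : EuclideanSpace ℝ (Fin n), ‖u‖ ≤ 1 → ‖w‖ = 1 →
      p ≤ μ.real {e | |inner ℝ e u| ≤ lam / 4 ∧ b < |inner ℝ e w|} := by
    refine le_measureReal_inter μ (by positivity) (fun u hu => ?_) (fun w hw => ?_)
    · have h := (h₁ n X hX).trans (iInf₂_le u (mem_sphere_zero_iff_norm.2 hu))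
      rw [← hset] at h
      exact (min_le_left _ _).trans ((ENNReal.ofReal_le_iff_le_toReal (measure_ne_top _ _)).1 h)
    · have h := (le_iSup₂ (f := fun v (_ : v ∈ Metric.sphere (0 : EuclideanSpace ℝ (Fin n)) 1) =>
        X.P {ω | |inner ℝ (X.X ω) v| ≤ b}) w (mem_sphere_zero_iff_norm.2 hw)).trans (h₂ n X hX)
      rw [← hset] at h
      exact ENNReal.toReal_le_of_le_ofReal (by positivity) h
  have hlaw : P.map (fun ω i => Y i ω) = Measure.pi fun _ : Fin m => μ := by
    rw [(iIndepFun_iff_map_fun_eq_pi_map fun i => (hid i).aemeasurable_fst).1 hind]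
    exact congrArg Measure.pi (funext fun i => (hid i).map_eq)
  have hbad := measure_pi_exists_sparse_le (ι := Fin m) hs hsn μ
    (show 0 < lam / 4 by positivity) hb (show 0 < p / 1024 by positivity) (by linarith) hmass
    (by rwa [Fintype.card_fin])
  have hfail := failure_bound_le hs hp0 hp1 hL hm
  rw [Fintype.card_fin, show 2 * (lam / 4) = lam / 2 by ring, ← hlaw] at hbad
  have hYm : AEMeasurable (fun ω i => Y i ω) P :=
    aemeasurable_pi_lambda _ fun i => (hid i).aemeasurable_fst
  have hbad' := ((Measure.le_map_apply hYm _).trans hbad).trans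
    (ENNReal.ofReal_le_ofReal hfail)
  have hgood := ofReal_one_sub_le_measure_of_compl_subset P (Real.exp_nonneg _) hbad'
  have hexp : Real.exp (-(p * m / 64)) ≤ Real.exp (-(c * m)) := by
    rw [Real.exp_le_exp]
    have := mul_le_mul_of_nonneg_right (min_le_left (p / 64) (p / 32 * min (b / 2) (lam / 4) ^ 2))
      (Nat.cast_nonneg (α := ℝ) m)
    linarith
  refine (ENNReal.ofReal_le_ofReal (by linarith)).trans (hgood.trans (measure_mono ?_))
  intro ω hω u hu v hv
  have h := le_mean_sq_clip_sub (ι := Fin m) (s := s) (c := c) hlam hb (min_le_right _ _)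
    (fun i => Y i ω)
    (fun J hJ q hq => by
      rw [Fintype.card_fin]
      exact not_lt.1 fun hlt => hω ⟨J, hJ, q, hq, hlt⟩) hu hv
  rwa [Fintype.card_fin] at h
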